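/- **Proposition (Uniqueness of weak solutions).** Let $n\ge 1$, let $\Omega\subset\mathbb{R}^n$ be a bounded open set with locally Lipschitz boundary, let $T>0$, and let $r$ be a real exponent with $r\ge 2$ and $r>n$. Let $y_0\in W^{1,r}_0(\Omega)$ and let $f\colon[0,T]\times\Omega\times\mathbb{R}\to\mathbb{R}$ satisfy: (a) for every $y\in\mathbb{R}$ the map $(t,x)\mapsto f(t,x,y)$ is (Lebesgue) measurable, for almost every $(t,x)\in[0,T]\times\Omega$ the map $y\mapsto f(t,x,y)$ is continuous on $\mathbb{R}$, and for every compact $K\subset\mathbb{R}$ there is $M_K\ge 0$ such that for almost every $(t,x)\in[0,T]\times\Omega$ one has $|f(t,x,y)|\le M_K$ for all $y\in K$; (b) for every compact $K\subset\mathbb{R}$ there is $L_K\ge 0$ such that for almost every $(t,x)\in[0,T]\times\Omega$ and all $u,v\in K$, $$(u-v)\bigl(f(t,x,u)-f(t,x,v)\bigr)\le L_K(u-v)^2 .$$ Let $X_r=H^1(0,T;W^{1,r}_0(\Omega))=\{y\in L^2(0,T;W^{1,r}_0(\Omega)) : \partial_t y\in L^2(0,T;W^{1,r}_0(\Omega))\}$,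 each element of $X_r$ being identified with its continuous representative on $[0,T]\times\overline\Omega$. A function $y\in X_r$ is called a weak solution of $$\partial_t y-\Delta_x y=f(t,x,y)\ \text{ in }(0,T]\times\Omega,\qquad y=0\ \text{ on }[0,T]\times\partial\Omega,\qquad y(0,\cdot)=y_0\ \text{ in }\Omega,$$ if $y(0,\cdot)=y_0$ in $\Omega$ and, for every $v\in H^1_0(\Omega)$ and every $\varphi\in C^\infty_c((0,T))$, $$\int_0^T\!\!\int_\Omega \varphi(t)\bigl[v(x)\,\partial_t y(t,x)+\nabla v(x)\cdot\nabla_x y(t,x)-v(x)\,f(t,x,y(t,x))\bigr]\,dx\,dt=0 .$$ Then this problem has at most one weak solution in $X_r$: if $y_1,y_2\in X_r$ are weak solutions, then $y_1=y_2$ on $[0,T]\times\overline\Omega$. -/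

import Mathlib

open MeasureTheory TopologicalSpace Set
open scoped ENNReal Distributions RealInnerProductSpace

namespace ReactionDiffusion

/-! ### Sobolev spaces -/

/-- `g` is the weak gradient of `u` on the open set `Ω`:
`∫_Ω u ∂ᵢφ = - ∫_Ω gᵢ φ` for every `φ ∈ C_c^∞(Ω)` and every coordinate `i`. -/
def HasWeakGradient {n : ℕ} (Ω : Opens (EuclideanSpace ℝ (Fin n)))
    (u : EuclideanSpace ℝ (Fin n) → ℝ)
    (g : EuclideanSpace ℝ (Fin n) → EuclideanSpace ℝ (Fin n)) : Prop :=
  ∀ (φ : 𝓓(Ω, ℝ)) (i : Fin n),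
    ∫ x in Ω, u x * fderiv ℝ φ x (EuclideanSpace.single i 1) = -∫ x in Ω, g x i * φ x

/-- An `L^p` function, composed with a continuous linear functional, is integrable against a
continuous function with compact support. -/
theorem integrable_apply_mul {n : ℕ} (Ω : Opens (EuclideanSpace ℝ (Fin n)))
    {F : Type*} [NormedAddCommGroup F] [NormedSpace ℝ F] (p : ℝ≥0∞) [hp : Fact (1 ≤ p)]
    (L : F →L[ℝ] ℝ) (ψ : EuclideanSpace ℝ (Fin n) → ℝ) (hψ : Continuous ψ)
    (hc : HasCompactSupport ψ)
    (u : Lp F p (volume.restrict (Ω : Set (EuclideanSpace ℝ (Fin n))))) :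
    Integrable (fun x => L (u x) * ψ x)
      (volume.restrict (Ω : Set (EuclideanSpace ℝ (Fin n)))) := by
  have h1 : LocallyIntegrable (fun x => L (u x))
      (volume.restrict (Ω : Set (EuclideanSpace ℝ (Fin n)))) :=
    (L.comp_memLp' (Lp.memLp u)).locallyIntegrable hp.out
  exact h1.integrable_smul_right_of_hasCompactSupport hψ hc

theorem continuous_integral_apply_mul {n : ℕ} (Ω : Opens (EuclideanSpace ℝ (Fin n)))
    {F : Type*} [NormedAddCommGroup F] [NormedSpace ℝ F] (p : ℝ≥0∞) [hp : Fact (1 ≤ p)]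
    (L : F →L[ℝ] ℝ) (ψ : EuclideanSpace ℝ (Fin n) → ℝ) (hψ : Continuous ψ)
    (hc : HasCompactSupport ψ) :
    Continuous (fun u : Lp F p (volume.restrict (Ω : Set (EuclideanSpace ℝ (Fin n)))) =>
      ∫ x in Ω, L (u x) * ψ x) := by
  have := ENNReal.HolderConjugate.conjExponent hp.out
  set q := ENNReal.conjExponent p
  have hq : Fact (1 ≤ q) := ⟨ENNReal.HolderConjugate.one_le q p⟩
  have hm : MemLp ψ q (volume.restrict (Ω : Set (EuclideanSpace ℝ (Fin n)))) :=
    (hψ.memLp_of_hasCompactSupport hc).restrict _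
  have hcont := (((ContinuousLinearMap.mul ℝ ℝ).comp L).lpPairing
    (volume.restrict (Ω : Set (EuclideanSpace ℝ (Fin n)))) p q).flip (hm.toLp ψ)
  have key : ∀ u : Lp F p (volume.restrict (Ω : Set (EuclideanSpace ℝ (Fin n)))),
      ∫ x in Ω, L (u x) * ψ x = (((ContinuousLinearMap.mul ℝ ℝ).comp L).lpPairing
        (volume.restrict (Ω : Set (EuclideanSpace ℝ (Fin n)))) p q).flip (hm.toLp ψ) u := by
    intro u
    rw [ContinuousLinearMap.flip_apply, ContinuousLinearMap.lpPairing_eq_integral]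
    refine integral_congr_ae ?_
    filter_upwards [hm.coeFn_toLp] with x hx
    simp [hx]
  simp_rw [key]
  exact ContinuousLinearMap.continuous _

theorem continuous_fderiv_testFunction {n : ℕ} {Ω : Opens (EuclideanSpace ℝ (Fin n))}
    (φ : 𝓓(Ω, ℝ)) (w : EuclideanSpace ℝ (Fin n)) : Continuous (fun x => fderiv ℝ φ x w) :=
  (φ.contDiff.continuous_fderiv (by simp)).clm_apply continuous_const

theorem hasCompactSupport_fderiv_testFunction {n : ℕ} {Ω : Opens (EuclideanSpace ℝ (Fin n))}
    (φ : 𝓓(Ω, ℝ)) (w : EuclideanSpace ℝ (Fin n)) :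
    HasCompactSupport (fun x => fderiv ℝ φ x w) :=
  φ.hasCompactSupport.fderiv_apply ℝ w

/-- The Sobolev space `W^{1,p}(Ω)`: functions `u ∈ L^p(Ω)` with a weak gradient in `L^p(Ω)^n`.
The function `u` is stored together with its (unique) weak gradient `g`, as the pair
`(u, g) ∈ L^p(Ω) × L^p(Ω)^n`. The norm `max (‖u‖_p) (‖∇u‖_p)` inherited from the product is
equivalent to the usual Sobolev norm. -/
noncomputable def W1p {n : ℕ} (Ω : Opens (EuclideanSpace ℝ (Fin n))) (p : ℝ≥0∞) [Fact (1 ≤ p)] :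
    Submodule ℝ (Lp ℝ p (volume.restrict (Ω : Set (EuclideanSpace ℝ (Fin n)))) ×
      Lp (EuclideanSpace ℝ (Fin n)) p (volume.restrict (Ω : Set (EuclideanSpace ℝ (Fin n))))) where
  carrier := {w | HasWeakGradient Ω w.1 w.2}
  zero_mem' := by
    intro φ i
    have h1 := Lp.coeFn_zero ℝ p (volume.restrict (Ω : Set (EuclideanSpace ℝ (Fin n))))
    have h2 := Lp.coeFn_zero (EuclideanSpace ℝ (Fin n)) p
      (volume.restrict (Ω : Set (EuclideanSpace ℝ (Fin n))))
    rw [integral_eq_zero_of_ae, integral_eq_zero_of_ae, neg_zero]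
    · filter_upwards [h2] with x hx
      have : (0 : Lp (EuclideanSpace ℝ (Fin n)) p
        (volume.restrict (Ω : Set (EuclideanSpace ℝ (Fin n))))) x i = 0 := by rw [hx]; rfl
      exact mul_eq_zero_of_left this _
    · filter_upwards [h1] with x hx
      exact mul_eq_zero_of_left hx _
  add_mem' := by
    intro a b ha hb φ i
    have h1 := Lp.coeFn_add a.1 b.1
    have h2 := Lp.coeFn_add a.2 b.2
    have i1 : ∀ c : Lp ℝ p (volume.restrict (Ω : Set (EuclideanSpace ℝ (Fin n)))),
        Integrable (fun x => c x * fderiv ℝ φ x (EuclideanSpace.single i 1))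
          (volume.restrict (Ω : Set (EuclideanSpace ℝ (Fin n)))) :=
      fun c => integrable_apply_mul Ω p (ContinuousLinearMap.id ℝ ℝ) _
      (continuous_fderiv_testFunction φ (EuclideanSpace.single i 1))
      (hasCompactSupport_fderiv_testFunction φ _) c
    have i2 : ∀ c : Lp (EuclideanSpace ℝ (Fin n)) p
          (volume.restrict (Ω : Set (EuclideanSpace ℝ (Fin n)))),
        Integrable (fun x => c x i * φ x)
          (volume.restrict (Ω : Set (EuclideanSpace ℝ (Fin n)))) :=
      fun c => integrable_apply_mul Ω p
      (EuclideanSpace.proj i : EuclideanSpace ℝ (Fin n) →L[ℝ] ℝ) _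
      φ.continuous φ.hasCompactSupport c
    have e1 : ∫ x in Ω, (a + b).1 x * fderiv ℝ φ x (EuclideanSpace.single i 1)
        = ∫ x in Ω, (a.1 x * fderiv ℝ φ x (EuclideanSpace.single i 1)
          + b.1 x * fderiv ℝ φ x (EuclideanSpace.single i 1)) := by
      refine integral_congr_ae ?_
      filter_upwards [h1] with x hx
      rw [show (a + b).1 x = a.1 x + b.1 x from hx, add_mul]
    have e2 : ∫ x in Ω, (a + b).2 x i * φ x
        = ∫ x in Ω, (a.2 x i * φ x + b.2 x i * φ x) := by
      refine integral_congr_ae ?_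
      filter_upwards [h2] with x hx
      rw [show (a + b).2 x = a.2 x + b.2 x from hx, PiLp.add_apply, add_mul]
    rw [e1, e2, integral_add (i1 a.1) (i1 b.1), integral_add (i2 a.2) (i2 b.2), ha φ i, hb φ i]
    ring
  smul_mem' := by
    intro c a ha φ i
    have h1 := Lp.coeFn_smul c a.1
    have h2 := Lp.coeFn_smul c a.2
    have e1 : ∫ x in Ω, (c • a).1 x * fderiv ℝ φ x (EuclideanSpace.single i 1)
        = ∫ x in Ω, c * (a.1 x * fderiv ℝ φ x (EuclideanSpace.single i 1)) := by
      refine integral_congr_ae ?_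
      filter_upwards [h1] with x hx
      rw [show (c • a).1 x = c * a.1 x from hx, mul_assoc]
    have e2 : ∫ x in Ω, (c • a).2 x i * φ x = ∫ x in Ω, c * (a.2 x i * φ x) := by
      refine integral_congr_ae ?_
      filter_upwards [h2] with x hx
      rw [show (c • a).2 x = c • a.2 x from hx, PiLp.smul_apply, smul_eq_mul, mul_assoc]
    rw [e1, e2, integral_const_mul, integral_const_mul, ha φ i]
    ring

theorem isClosed_W1p {n : ℕ} (Ω : Opens (EuclideanSpace ℝ (Fin n))) (p : ℝ≥0∞)
    [Fact (1 ≤ p)] :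
    IsClosed (W1p Ω p : Set (Lp ℝ p (volume.restrict (Ω : Set (EuclideanSpace ℝ (Fin n)))) ×
      Lp (EuclideanSpace ℝ (Fin n)) p
        (volume.restrict (Ω : Set (EuclideanSpace ℝ (Fin n)))))) := by
  change IsClosed {w : Lp ℝ p (volume.restrict (Ω : Set (EuclideanSpace ℝ (Fin n)))) ×
      Lp (EuclideanSpace ℝ (Fin n)) p (volume.restrict (Ω : Set (EuclideanSpace ℝ (Fin n)))) |
      HasWeakGradient Ω w.1 w.2}
  simp only [HasWeakGradient, ofPred_forall]
  refine isClosed_iInter fun φ => isClosed_iInter fun i => isClosed_eq ?_ ?_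
  · exact (continuous_integral_apply_mul Ω p (ContinuousLinearMap.id ℝ ℝ) _
      (continuous_fderiv_testFunction φ (EuclideanSpace.single i 1))
      (hasCompactSupport_fderiv_testFunction φ _)).comp continuous_fst
  · exact ((continuous_integral_apply_mul Ω p
      (EuclideanSpace.proj i : EuclideanSpace ℝ (Fin n) →L[ℝ] ℝ) _
      φ.continuous φ.hasCompactSupport).comp continuous_snd).neg

instance instCompleteSpaceW1p {n : ℕ} (Ω : Opens (EuclideanSpace ℝ (Fin n))) (p : ℝ≥0∞)
    [Fact (1 ≤ p)] : CompleteSpace (W1p Ω p) :=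
  (isClosed_W1p Ω p).completeSpace_coe

/-- The space `C_c^∞(Ω)`, as a subspace of `W^{1,p}(Ω)`. -/
noncomputable def smoothCompactlySupported {n : ℕ} (Ω : Opens (EuclideanSpace ℝ (Fin n))) (p : ℝ≥0∞)
    [Fact (1 ≤ p)] : Submodule ℝ (W1p Ω p) where
  carrier := {w | ∃ φ : 𝓓(Ω, ℝ),
    w.1.1 =ᵐ[volume.restrict (Ω : Set (EuclideanSpace ℝ (Fin n)))] φ}
  zero_mem' := ⟨0, by
    filter_upwards [Lp.coeFn_zero ℝ p
      (volume.restrict (Ω : Set (EuclideanSpace ℝ (Fin n))))] with x hx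
    simpa using hx⟩
  add_mem' := by
    rintro a b ⟨φ, hφ⟩ ⟨ψ, hψ⟩
    refine ⟨φ + ψ, ?_⟩
    filter_upwards [hφ, hψ, Lp.coeFn_add a.1.1 b.1.1] with x h1 h2 h3
    simpa [h1, h2] using h3
  smul_mem' := by
    rintro c a ⟨φ, hφ⟩
    refine ⟨c • φ, ?_⟩
    filter_upwards [hφ, Lp.coeFn_smul c a.1.1] with x h1 h3
    simpa [h1] using h3

/-- The space `W_0^{1,p}(Ω)`: the closure of `C_c^∞(Ω)` in `W^{1,p}(Ω)`. -/
noncomputable def W01p {n : ℕ} (Ω : Opens (EuclideanSpace ℝ (Fin n))) (p : ℝ≥0∞) [Fact (1 ≤ p)] :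
    Submodule ℝ (W1p Ω p) :=
  (smoothCompactlySupported Ω p).topologicalClosure

/-- Completeness, so that Bochner integrals of `W_0^{1,p}(Ω)`-valued functions make sense. -/
instance instCompleteSpaceW01p {n : ℕ} (Ω : Opens (EuclideanSpace ℝ (Fin n))) (p : ℝ≥0∞)
    [Fact (1 ≤ p)] : CompleteSpace (W01p Ω p) :=
  (Submodule.isClosed_topologicalClosure _).completeSpace_coe

/-- The underlying `L^p` function of an element of `W_0^{1,p}(Ω)`. -/
noncomputable def toLp {n : ℕ} {Ω : Opens (EuclideanSpace ℝ (Fin n))} {p : ℝ≥0∞} [Fact (1 ≤ p)]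
    (w : W01p Ω p) : Lp ℝ p (volume.restrict (Ω : Set (EuclideanSpace ℝ (Fin n)))) :=
  w.1.1.1

/-- The weak gradient of an element of `W_0^{1,p}(Ω)`. -/
noncomputable def weakGrad {n : ℕ} {Ω : Opens (EuclideanSpace ℝ (Fin n))} {p : ℝ≥0∞} [Fact (1 ≤ p)]
    (w : W01p Ω p) : Lp (EuclideanSpace ℝ (Fin n)) p
      (volume.restrict (Ω : Set (EuclideanSpace ℝ (Fin n)))) :=
  w.1.1.2

/-! ### Functions of time with values in a Banach space -/

/-- The open time interval `(0, T)`. -/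
def timeInterval (T : ℝ) : Opens ℝ := ⟨Ioo 0 T, isOpen_Ioo⟩

/-- `Y ∈ H^1(0,T;B)` with weak time derivative `Y'`: both `Y` and `Y'` belong to the Bochner space
`L^2(0,T;B)` and `∫_0^T φ' Y = - ∫_0^T φ Y'` in `B` for every `φ ∈ C_c^∞((0,T))`. -/
structure IsH1WithDeriv {B : Type*} [NormedAddCommGroup B] [NormedSpace ℝ B]
    (T : ℝ) (Y Y' : ℝ → B) : Prop where
  memLp : MemLp Y 2 (volume.restrict (Ioo 0 T))
  memLp_deriv : MemLp Y' 2 (volume.restrict (Ioo 0 T))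
  weak_deriv : ∀ φ : 𝓓(timeInterval T, ℝ),
    ∫ t in Ioo 0 T, deriv φ t • Y t = -∫ t in Ioo 0 T, φ t • Y' t

/-- `y` is the continuous representative on `[0,T] × closure Ω` of an element of
`X_r = H^1(0,T;W_0^{1,r}(Ω))`, whose realisation as a `W_0^{1,r}(Ω)`-valued map is `Y`
(that is, `Y(t) = y(t,·)` for almost every `t`), and `Y'` is its weak time derivative. -/
structure RepresentsXr {n : ℕ} (Ω : Opens (EuclideanSpace ℝ (Fin n))) (r : ℝ≥0∞)
    [Fact (1 ≤ r)] (T : ℝ) (y : ℝ → EuclideanSpace ℝ (Fin n) → ℝ)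
    (Y Y' : ℝ → W01p Ω r) : Prop where
  continuousOn : ContinuousOn (fun z : ℝ × EuclideanSpace ℝ (Fin n) => y z.1 z.2)
    (Icc 0 T ×ˢ closure (Ω : Set (EuclideanSpace ℝ (Fin n))))
  isH1 : IsH1WithDeriv T Y Y'
  eq_slice : ∀ᵐ t ∂volume.restrict (Ioo 0 T),
    toLp (Y t) =ᵐ[volume.restrict (Ω : Set (EuclideanSpace ℝ (Fin n)))] y t

/-! ### Data of the equation -/

/-- `Ω` has a locally Lipschitz boundary: near each boundary point, for a suitable direction `e`,
`Ω` is the set of points lying strictly above the graph (in the direction `e`) of a Lipschitz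
function defined on the hyperplane orthogonal to `e`. -/
def HasLocallyLipschitzBoundary {n : ℕ} (Ω : Set (EuclideanSpace ℝ (Fin n))) : Prop :=
  ∀ x₀ ∈ frontier Ω, ∃ e : EuclideanSpace ℝ (Fin n), ‖e‖ = 1 ∧
    ∃ (K : NNReal) (γ : (ℝ ∙ e)ᗮ → ℝ), LipschitzWith K γ ∧
      ∃ δ > 0, ∀ x ∈ Metric.ball x₀ δ,
        (x ∈ Ω ↔ γ ((ℝ ∙ e)ᗮ.orthogonalProjectionOnto x) < ⟪e, x⟫)

/-- Hypotheses on `f : [0,T] × Ω × ℝ → ℝ` making it an essentially locally bounded Carathéodory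
function: measurable in `(t,x)`, continuous in `y`, essentially bounded in `(t,x)` locally
uniformly in `y`. -/
structure IsLocallyBoundedCaratheodory {n : ℕ} (T : ℝ) (Ω : Set (EuclideanSpace ℝ (Fin n)))
    (f : ℝ → EuclideanSpace ℝ (Fin n) → ℝ → ℝ) : Prop where
  aemeasurable : ∀ u : ℝ, AEMeasurable (fun z : ℝ × EuclideanSpace ℝ (Fin n) => f z.1 z.2 u)
    (volume.restrict (Icc 0 T ×ˢ Ω))
  continuous : ∀ᵐ z : ℝ × EuclideanSpace ℝ (Fin n) ∂volume.restrict (Icc 0 T ×ˢ Ω),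
    Continuous (f z.1 z.2)
  bounded : ∀ K : Set ℝ, IsCompact K → ∃ M : ℝ, 0 ≤ M ∧
    ∀ᵐ z : ℝ × EuclideanSpace ℝ (Fin n) ∂volume.restrict (Icc 0 T ×ˢ Ω),
      ∀ u ∈ K, |f z.1 z.2 u| ≤ M

/-- `f` is locally one-sided Lipschitz in its last variable, essentially in `(t,x)`. -/
def IsLocallyOneSidedLipschitz {n : ℕ} (T : ℝ) (Ω : Set (EuclideanSpace ℝ (Fin n)))
    (f : ℝ → EuclideanSpace ℝ (Fin n) → ℝ → ℝ) : Prop :=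
  ∀ K : Set ℝ, IsCompact K → ∃ L : ℝ, 0 ≤ L ∧
    ∀ᵐ z : ℝ × EuclideanSpace ℝ (Fin n) ∂volume.restrict (Icc 0 T ×ˢ Ω),
      ∀ u ∈ K, ∀ v ∈ K, (u - v) * (f z.1 z.2 u - f z.1 z.2 v) ≤ L * (u - v) ^ 2

/-- `y` is (the continuous representative of) a weak solution in `X_r = H^1(0,T;W_0^{1,r}(Ω))` of
`∂_t y - Δ y = f(t,x,y)` in `(0,T] × Ω`, `y = 0` on `∂Ω`, `y(0,·) = y₀`. -/
def IsWeakSolution {n : ℕ} (Ω : Opens (EuclideanSpace ℝ (Fin n))) (r : ℝ≥0∞) [Fact (1 ≤ r)]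
    (T : ℝ) (f : ℝ → EuclideanSpace ℝ (Fin n) → ℝ → ℝ) (y₀ : W01p Ω r)
    (y : ℝ → EuclideanSpace ℝ (Fin n) → ℝ) : Prop :=
  ∃ Y Y' : ℝ → W01p Ω r, RepresentsXr Ω r T y Y Y' ∧
    (∀ (v : W01p Ω 2) (φ : 𝓓(timeInterval T, ℝ)),
      ∫ t in Ioo 0 T, ∫ x in Ω,
        φ t * (toLp v x * toLp (Y' t) x + ⟪weakGrad v x, weakGrad (Y t) x⟫ - toLp v x * f t x (y t x)) = 0) ∧
    y 0 =ᵐ[volume.restrict (Ω : Set (EuclideanSpace ℝ (Fin n)))] toLp y₀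

end ReactionDiffusion

/-!
Let `w = y₁ - y₂` be the difference of two weak solutions. The proof is the energy method: testing
the difference of the two equations with `w` itself gives, for almost every `t`,
`(w, ∂ₜw) + ‖∇w‖² = ∫ w (f(y₁) - f(y₂)) ≤ L ‖w‖²` in `L²(Ω)`, the inequality being the one-sided
Lipschitz condition on the compact set of all values of `y₁` and `y₂`. Since
`w(0) = 0`, Grönwall's inequality forces `‖w(t)‖ = 0` for all `t`, and continuity gives `w = 0` on
the closed cylinder.

Three points need work. Testing with `w` is legitimate because the equation can be localised in
time: `W_0^{1,2}(Ω)` is separable, so for almost every `t` the equation holds against all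
`v ∈ W_0^{1,2}(Ω)` at once (`ae_forall_weak_formulation`), and `W_0^{1,r}(Ω) ⊆ W_0^{1,2}(Ω)` because
`Ω` is bounded and `r ≥ 2` (`exists_W01p_two_eq`). The superposition `f(t,x,y(t,x))` is measurable
by approximating `y` by simple functions
(`IsLocallyBoundedCaratheodory.aestronglyMeasurable_comp`). Finally, an `H^1` function of time is a
constant plus the primitive of its weak derivative (`ae_eq_const_add_primitive`), and Fubini's
theorem on a triangle replaces the product rule for `‖w‖²` (`setIntegral_bilin_primitive`,
`norm_sq_primitive`); these combine to `IsH1WithDeriv.eq_zero_of_inner_le`.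
-/

namespace ReactionDiffusion

/-! ### Primitives and weak derivatives in time -/

/-- Integration by parts for two primitives. It is Fubini's theorem on the square `(a,b]²`, split
along its diagonal, and needs no differentiability. -/
theorem setIntegral_bilin_primitive {E F G : Type*}
    [NormedAddCommGroup E] [NormedSpace ℝ E] [CompleteSpace E]
    [NormedAddCommGroup F] [NormedSpace ℝ F] [CompleteSpace F]
    [NormedAddCommGroup G] [NormedSpace ℝ G] [CompleteSpace G]
    (B : E →L[ℝ] F →L[ℝ] G) {f : ℝ → E} {g : ℝ → F} {a b : ℝ}
    (hf : IntegrableOn f (Ioc a b)) (hg : IntegrableOn g (Ioc a b)) :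
    (∫ s in Ioc a b, B (f s) (∫ τ in Ioc a s, g τ)) +
      (∫ s in Ioc a b, B (∫ τ in Ioc a s, f τ) (g s)) =
      B (∫ s in Ioc a b, f s) (∫ s in Ioc a b, g s) := by
  set μ := (volume : Measure ℝ).restrict (Ioc a b) with hμ
  have hk : Integrable (fun z : ℝ × ℝ => B (f z.1) (g z.2)) (μ.prod μ) :=
    hf.op_fst_snd (op := fun x y => B x y) (by fun_prop) ⟨‖B‖, B.le_opNorm₂⟩ hg
  have hS : MeasurableSet {z : ℝ × ℝ | z.2 ≤ z.1} := measurableSet_le measurable_snd measurable_fst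
  rw [← integral_prod_bilin B hf hg, ← integral_add_compl hS hk]
  -- below the diagonal integrate first in `τ`, above it first in `s`
  congr 1
  · rw [← integral_indicator hS, integral_prod _ (hk.indicator hS)]
    refine integral_congr_ae ?_
    filter_upwards [ae_restrict_mem measurableSet_Ioc] with s hs
    have h1 : ∀ τ, {z : ℝ × ℝ | z.2 ≤ z.1}.indicator (fun z => B (f z.1) (g z.2)) (s, τ)
        = (Iic s).indicator (fun τ => B (f s) (g τ)) τ := by
      intro τ; simp [indicator]
    simp_rw [h1]
    have h2 : Ioc a b ∩ Iic s = Ioc a s := by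
      ext τ; simp only [mem_inter_iff, mem_Ioc, mem_Iic]; have := hs.2; grind
    rw [integral_indicator measurableSet_Iic, hμ, Measure.restrict_restrict measurableSet_Iic,
      inter_comm, h2]
    exact ((B (f s)).integral_comp_comm (hg.mono_set (Ioc_subset_Ioc_right hs.2))).symm
  · rw [← integral_indicator hS.compl, integral_prod_symm _ (hk.indicator hS.compl)]
    refine integral_congr_ae ?_
    filter_upwards [ae_restrict_mem measurableSet_Ioc] with s hs
    have h1 : ∀ τ, {z : ℝ × ℝ | z.2 ≤ z.1}ᶜ.indicator (fun z => B (f z.1) (g z.2)) (τ, s)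
        = (Iio s).indicator (fun τ => B (f τ) (g s)) τ := by
      intro τ; simp [indicator, ← not_lt]
    simp_rw [h1]
    have h2 : Ioc a b ∩ Iio s = Ioo a s := by
      ext τ; simp only [mem_inter_iff, mem_Ioc, mem_Iio, mem_Ioo]; have := hs.2; grind
    rw [integral_indicator measurableSet_Iio, hμ, Measure.restrict_restrict measurableSet_Iio,
      inter_comm, h2, ← integral_Ioc_eq_integral_Ioo]
    exact ((B.flip (g s)).integral_comp_comm (hf.mono_set (Ioc_subset_Ioc_right hs.2))).symm

/-- The primitive of a test function on `(0,T)` with vanishing integral is again a test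
function. -/
theorem exists_testFunction_deriv_eq {T : ℝ} (ψ : 𝓓(timeInterval T, ℝ))
    (hψ : ∫ t in Ioo 0 T, ψ t = 0) :
    ∃ φ : 𝓓(timeInterval T, ℝ), deriv φ = ψ := by
  have hsub : tsupport ψ ⊆ Ioo 0 T := ψ.tsupport_subset
  have hcpt : IsCompact (tsupport ψ) := ψ.hasCompactSupport
  have hT : ∫ t in (0 : ℝ)..T, ψ t = 0 := by
    rcases le_total 0 T with h | h
    · rw [intervalIntegral.integral_of_le h, integral_Ioc_eq_integral_Ioo, hψ]
    · have : (ψ : ℝ → ℝ) = 0 := by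
        rw [← tsupport_eq_empty_iff]
        exact subset_empty_iff.1 (hsub.trans (by rw [Ioo_eq_empty (not_lt.2 h)]))
      simp [this]
  have hd : ∀ t, HasDerivAt (fun t => ∫ s in (0 : ℝ)..t, ψ s) (ψ t) t := fun t =>
    ψ.continuous.integral_hasStrictDerivAt 0 t |>.hasDerivAt
  have hder : deriv (fun t => ∫ s in (0 : ℝ)..t, ψ s) = ψ := funext fun t => (hd t).deriv
  obtain ⟨a, b, hK, ha, hb⟩ : ∃ a b : ℝ, tsupport ψ ⊆ Icc a b ∧ 0 < a ∧ b < T := by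
    rcases (tsupport ψ).eq_empty_or_nonempty with h | h
    · exact ⟨1, T - 1, by simp [h], one_pos, by linarith⟩
    · obtain ⟨a, ha⟩ := hcpt.exists_isLeast h
      obtain ⟨b, hb⟩ := hcpt.exists_isGreatest h
      exact ⟨a, b, fun x hx => ⟨ha.2 hx, hb.2 hx⟩, (hsub ha.1).1, (hsub hb.1).2⟩
  have hz : ∀ s, s ∉ Icc a b → ψ s = 0 := fun s hs => image_eq_zero_of_notMem_tsupport
    fun h => hs (hK h)
  have hsupp : tsupport (fun t => ∫ s in (0 : ℝ)..t, ψ s) ⊆ Icc a b := by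
    refine closure_minimal ?_ isClosed_Icc
    intro t ht
    by_contra hn
    apply ht
    rcases lt_or_ge t a with h | h
    · refine intervalIntegral.integral_zero_ae (.of_forall fun s hs => hz s fun h' => ?_)
      have := hs.2
      have := h'.1
      grind
    · have hbt : b < t := by by_contra h'; exact hn ⟨h, not_lt.1 h'⟩
      beta_reduce
      rw [← intervalIntegral.integral_add_adjacent_intervals
        (ψ.continuous.intervalIntegrable 0 T) (ψ.continuous.intervalIntegrable T t), hT, zero_add]
      refine intervalIntegral.integral_zero_ae (.of_forall fun s hs => hz s fun h' => ?_)
      have := hs.1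
      have := h'.2
      grind
  refine ⟨⟨fun t => ∫ s in (0 : ℝ)..t, ψ s, ?_, ?_, ?_⟩, ?_⟩
  · refine contDiff_infty_iff_deriv.2 ⟨fun t => (hd t).differentiableAt, ?_⟩
    rw [hder]
    exact ψ.contDiff
  · exact HasCompactSupport.intro' isCompact_Icc isClosed_Icc
      fun x hx => image_eq_zero_of_notMem_tsupport (f := fun t => ∫ s in (0 : ℝ)..t, ψ s)
        fun h => hx (hsupp h)
  · exact fun x hx => ⟨ha.trans_le (hsupp hx).1, (hsupp hx).2.trans_lt hb⟩
  · exact hder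

theorem integrable_testFunction_smul {B : Type*} [NormedAddCommGroup B] [NormedSpace ℝ B]
    {T : ℝ} (φ : 𝓓(timeInterval T, ℝ)) {U : ℝ → B} (hU : IntegrableOn U (Ioo 0 T)) :
    IntegrableOn (fun t => φ t • U t) (Ioo 0 T) := by
  obtain ⟨C, hC⟩ := φ.continuous.bounded_above_of_compact_support φ.hasCompactSupport
  exact Integrable.bdd_smul hU C φ.continuous.aestronglyMeasurable (.of_forall hC)

/-- The fundamental lemma of the calculus of variations on `(0,T)`, for test functions. -/
theorem ae_eq_zero_of_forall_testFunction {B : Type*} [NormedAddCommGroup B] [NormedSpace ℝ B]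
    [CompleteSpace B] {T : ℝ} {U : ℝ → B} (hU : IntegrableOn U (Ioo 0 T))
    (h : ∀ φ : 𝓓(timeInterval T, ℝ), ∫ t in Ioo 0 T, φ t • U t = 0) :
    ∀ᵐ t ∂volume.restrict (Ioo 0 T), U t = 0 := by
  rw [ae_restrict_iff' measurableSet_Ioo]
  refine isOpen_Ioo.ae_eq_zero_of_integral_contDiff_smul_eq_zero hU.locallyIntegrableOn ?_
  intro g hg hc hs
  rw [← h ⟨g, hg, hc, hs⟩, eq_comm]
  refine setIntegral_eq_integral_of_forall_compl_eq_zero fun t ht => ?_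
  have : g t = 0 := image_eq_zero_of_notMem_tsupport fun h' => ht (hs h')
  change g t • U t = 0
  rw [this, zero_smul]

/-- A function on `(0,T)` with vanishing weak derivative is constant (du Bois-Reymond). -/
theorem ae_eq_const_of_weak_deriv_eq_zero {B : Type*} [NormedAddCommGroup B] [NormedSpace ℝ B]
    [CompleteSpace B] {T : ℝ} (hT : 0 < T) {U : ℝ → B} (hU : IntegrableOn U (Ioo 0 T))
    (h : ∀ φ : 𝓓(timeInterval T, ℝ), ∫ t in Ioo 0 T, deriv φ t • U t = 0) :
    ∃ c : B, ∀ᵐ t ∂volume.restrict (Ioo 0 T), U t = c := by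
  obtain ⟨η, hη⟩ : ∃ η : 𝓓(timeInterval T, ℝ), ∫ t in Ioo 0 T, η t = 1 := by
    let b : ContDiffBump (T / 2) := ⟨T / 8, T / 4, by linarith, by linarith⟩
    have hs : tsupport (b.normed volume) ⊆ Ioo 0 T := by
      rw [b.tsupport_normed_eq, Real.closedBall_eq_Icc]
      exact fun x hx => ⟨by have := hx.1; simp only [b] at this; linarith,
        by have := hx.2; simp only [b] at this; linarith⟩
    refine ⟨⟨b.normed volume, b.contDiff_normed, b.hasCompactSupport_normed, hs⟩, ?_⟩
    rw [← b.integral_normed (μ := volume)]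
    exact setIntegral_eq_integral_of_forall_compl_eq_zero fun t ht =>
      image_eq_zero_of_notMem_tsupport fun h' => ht (hs h')
  have hi : ∀ φ : 𝓓(timeInterval T, ℝ), IntegrableOn φ (Ioo 0 T) := fun φ =>
    (φ.continuous.integrable_of_hasCompactSupport φ.hasCompactSupport).integrableOn
  set c := ∫ t in Ioo 0 T, η t • U t with hc
  have hconst : IntegrableOn (fun _ : ℝ => c) (Ioo 0 T) := by simp [IntegrableOn]
  refine ⟨c, ?_⟩
  have key := ae_eq_zero_of_forall_testFunction (U := fun t => U t - c) (hU.sub hconst) ?_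
  · filter_upwards [key] with t ht using sub_eq_zero.1 ht
  intro ψ
  -- `ψ` minus the multiple of `η` with the same integral is the derivative of a test function
  set m := ∫ t in Ioo 0 T, ψ t with hm
  obtain ⟨φ, hφ⟩ := exists_testFunction_deriv_eq (ψ - m • η) (by
    simp only [FunLike.coe_sub, FunLike.coe_smul, Pi.sub_apply, Pi.smul_apply, smul_eq_mul]
    rw [integral_sub (hi ψ) ((hi η).const_mul m), integral_const_mul, hη, mul_one, sub_self])
  have h0 := h φ
  rw [hφ] at h0
  simp only [FunLike.coe_sub, FunLike.coe_smul, Pi.sub_apply, Pi.smul_apply, smul_eq_mul,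
    sub_smul, mul_smul] at h0
  rw [integral_sub (f := fun t => ψ t • U t) (g := fun t => m • η t • U t)
    (integrable_testFunction_smul ψ hU) ((integrable_testFunction_smul η hU).smul m),
    integral_smul, ← hc] at h0
  simp only [smul_sub]
  rw [integral_sub (integrable_testFunction_smul ψ hU) ((hi ψ).smul_const c),
    integral_smul_const, ← hm, h0]

theorem integrable_deriv_testFunction_smul {B : Type*} [NormedAddCommGroup B] [NormedSpace ℝ B]
    {T : ℝ} (φ : 𝓓(timeInterval T, ℝ)) {U : ℝ → B} (hU : IntegrableOn U (Ioo 0 T)) :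
    IntegrableOn (fun t => deriv φ t • U t) (Ioo 0 T) := by
  have hc : Continuous (deriv φ) := φ.contDiff.continuous_deriv (by simp)
  obtain ⟨C, hC⟩ := hc.bounded_above_of_compact_support φ.hasCompactSupport.deriv
  exact Integrable.bdd_smul hU C hc.aestronglyMeasurable (.of_forall hC)

theorem IsH1WithDeriv.integrableOn {B : Type*} [NormedAddCommGroup B] [NormedSpace ℝ B]
    {T : ℝ} {Y Y' : ℝ → B} (hY : IsH1WithDeriv T Y Y') : IntegrableOn Y (Ioo 0 T) :=
  hY.memLp.integrable (by norm_num)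

theorem IsH1WithDeriv.integrableOn_deriv {B : Type*} [NormedAddCommGroup B] [NormedSpace ℝ B]
    {T : ℝ} {Y Y' : ℝ → B} (hY : IsH1WithDeriv T Y Y') : IntegrableOn Y' (Ioo 0 T) :=
  hY.memLp_deriv.integrable (by norm_num)

theorem IsH1WithDeriv.sub {B : Type*} [NormedAddCommGroup B] [NormedSpace ℝ B]
    {T : ℝ} {Y Y' Z Z' : ℝ → B} (hY : IsH1WithDeriv T Y Y') (hZ : IsH1WithDeriv T Z Z') :
    IsH1WithDeriv T (fun t => Y t - Z t) (fun t => Y' t - Z' t) where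
  memLp := hY.memLp.sub hZ.memLp
  memLp_deriv := hY.memLp_deriv.sub hZ.memLp_deriv
  weak_deriv φ := by
    simp only [smul_sub]
    rw [integral_sub (integrable_deriv_testFunction_smul φ hY.integrableOn)
        (integrable_deriv_testFunction_smul φ hZ.integrableOn),
      integral_sub (integrable_testFunction_smul φ hY.integrableOn_deriv)
        (integrable_testFunction_smul φ hZ.integrableOn_deriv), hY.weak_deriv, hZ.weak_deriv]
    abel

theorem IsH1WithDeriv.clm_comp {B C : Type*} [NormedAddCommGroup B] [NormedSpace ℝ B]
    [CompleteSpace B] [NormedAddCommGroup C] [NormedSpace ℝ C] [CompleteSpace C]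
    {T : ℝ} {Y Y' : ℝ → B} (hY : IsH1WithDeriv T Y Y') (A : B →L[ℝ] C) :
    IsH1WithDeriv T (fun t => A (Y t)) (fun t => A (Y' t)) where
  memLp := A.comp_memLp' hY.memLp
  memLp_deriv := A.comp_memLp' hY.memLp_deriv
  weak_deriv φ := by
    simp only [← map_smul]
    rw [A.integral_comp_comm (integrable_deriv_testFunction_smul φ hY.integrableOn),
      A.integral_comp_comm (integrable_testFunction_smul φ hY.integrableOn_deriv),
      hY.weak_deriv, map_neg]

theorem integrableOn_const_inner {H : Type*} [NormedAddCommGroup H] [InnerProductSpace ℝ H]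
    {s : Set ℝ} {U : ℝ → H} (hU : IntegrableOn U s) (a : H) :
    IntegrableOn (fun t => ⟪a, U t⟫) s :=
  (innerSL ℝ a).integrable_comp hU

/-- An element of `H^1(0,T;B)` is, up to a constant, the primitive of its weak derivative. -/
theorem ae_eq_const_add_primitive {B : Type*} [NormedAddCommGroup B] [NormedSpace ℝ B]
    [CompleteSpace B] {T : ℝ} (hT : 0 < T) {Z Z' : ℝ → B} (hZ : IsH1WithDeriv T Z Z') :
    ∃ c : B, ∀ᵐ t ∂volume.restrict (Ioo 0 T), Z t = c + ∫ s in Ioc 0 t, Z' s := by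
  have hZc : IntegrableOn Z' (Ioc 0 T) :=
    (integrableOn_Ioc_iff_integrableOn_Ioo).2 hZ.integrableOn_deriv
  have hP : IntegrableOn (fun t => ∫ s in Ioc 0 t, Z' s) (Ioo 0 T) :=
    ((intervalIntegral.continuousOn_primitive ((integrableOn_Icc_iff_integrableOn_Ioc).2
      hZc)).integrableOn_Icc).mono_set Ioo_subset_Icc_self
  suffices h : ∀ φ : 𝓓(timeInterval T, ℝ),
      ∫ t in Ioo 0 T, deriv φ t • (Z t - ∫ s in Ioc 0 t, Z' s) = 0 by
    obtain ⟨c, hc⟩ := ae_eq_const_of_weak_deriv_eq_zero hT (hZ.integrableOn.sub hP) h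
    refine ⟨c, ?_⟩
    filter_upwards [hc] with t ht
    rw [← ht]
    simp
  intro φ
  have hφ' : Continuous (deriv φ) := φ.contDiff.continuous_deriv (by simp)
  have hφd : ∀ t, HasDerivAt φ (deriv φ t) t := fun t =>
    (φ.contDiff.differentiable (by simp)).differentiableAt.hasDerivAt
  have hφ0 : ∀ t, t ∉ Ioo 0 T → φ t = 0 := fun t ht =>
    image_eq_zero_of_notMem_tsupport fun h' => ht (φ.tsupport_subset h')
  have hprim : ∀ t, 0 ≤ t → ∫ s in Ioc 0 t, deriv φ s = φ t := by
    intro t ht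
    rw [← intervalIntegral.integral_of_le ht,
      intervalIntegral.integral_eq_sub_of_hasDerivAt (fun s _ => hφd s)
      (hφ'.intervalIntegrable _ _), hφ0 0 (by simp), sub_zero]
  have hibp := setIntegral_bilin_primitive (ContinuousLinearMap.lsmul ℝ ℝ : ℝ →L[ℝ] B →L[ℝ] B)
    (a := 0) (b := T) (f := deriv φ) (hφ'.continuousOn.integrableOn_Icc.mono_set
      Ioc_subset_Icc_self) hZc
  rw [hprim T hT.le, hφ0 T (by simp)] at hibp
  simp only [ContinuousLinearMap.lsmul_apply, zero_smul] at hibp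
  have e2 : ∫ s in Ioc 0 T, (∫ τ in Ioc 0 s, deriv φ τ) • Z' s = ∫ s in Ioo 0 T, φ s • Z' s := by
    rw [← integral_Ioc_eq_integral_Ioo]
    exact setIntegral_congr_fun measurableSet_Ioc fun s hs => by simp [hprim s hs.1.le]
  simp only [smul_sub]
  rw [integral_sub (integrable_deriv_testFunction_smul φ hZ.integrableOn)
    (integrable_deriv_testFunction_smul φ hP), hZ.weak_deriv φ, ← e2,
    ← integral_Ioc_eq_integral_Ioo,
    eq_neg_of_add_eq_zero_left hibp, sub_self]

/-- The chain rule for `‖·‖²` along a primitive, in integrated form. -/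
theorem norm_sq_primitive {H : Type*} [NormedAddCommGroup H] [InnerProductSpace ℝ H]
    [CompleteSpace H] {a b : ℝ} {g : ℝ → H} (hg : IntegrableOn g (Ioc a b)) :
    ‖∫ s in Ioc a b, g s‖ ^ 2 = 2 * ∫ s in Ioc a b, ⟪∫ τ in Ioc a s, g τ, g s⟫ := by
  have h := setIntegral_bilin_primitive (innerSL ℝ : H →L[ℝ] H →L[ℝ] ℝ) hg hg
  change (∫ s in Ioc a b, ⟪g s, ∫ τ in Ioc a s, g τ⟫) +
    (∫ s in Ioc a b, ⟪∫ τ in Ioc a s, g τ, g s⟫)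
    = ⟪∫ s in Ioc a b, g s, ∫ s in Ioc a b, g s⟫ at h
  rw [← real_inner_self_eq_norm_sq, ← h, two_mul]
  congr 1
  exact integral_congr_ae (.of_forall fun s => real_inner_comm _ _)

/-- Integral form of Grönwall's inequality, for a vanishing initial value. -/
theorem le_zero_of_le_mul_integral {T L : ℝ} (hL : 0 ≤ L) {h : ℝ → ℝ}
    (hc : ContinuousOn h (Icc 0 T))
    (hle : ∀ t ∈ Icc 0 T, h t ≤ L * ∫ s in (0 : ℝ)..t, h s) :
    ∀ t ∈ Icc 0 T, h t ≤ 0 := by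
  intro t ht
  have hT : (0 : ℝ) ≤ T := ht.1.trans ht.2
  have hint : ∀ x ∈ Icc 0 T, IntervalIntegrable h volume 0 x := fun x hx =>
    ContinuousOn.intervalIntegrable (by
      rw [uIcc_of_le hx.1]; exact hc.mono (Icc_subset_Icc_right hx.2))
  have hH : ContinuousOn (fun x => ∫ s in (0 : ℝ)..x, h s) (Icc 0 T) := by
    have := intervalIntegral.continuousOn_primitive_interval' (hint T ⟨hT, le_rfl⟩) left_mem_uIcc
    rwa [uIcc_of_le hT] at this
  have hd : ∀ x ∈ Ico 0 T, HasDerivWithinAt (fun x => ∫ s in (0 : ℝ)..x, h s) (h x) (Ici x) x := by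
    intro x hx
    have hcx : ContinuousWithinAt h (Ici x) x :=
      ((hc x ⟨hx.1, hx.2.le⟩).mono (Icc_subset_Icc_left hx.1)).mono_of_mem_nhdsWithin
        (Icc_mem_nhdsGE hx.2)
    have hm : StronglyMeasurableAtFilter h (nhdsWithin x (Ioi x)) volume :=
      ⟨Ioc x T, Ioc_mem_nhdsGT hx.2,
        (hc.mono (fun y hy => ⟨hx.1.trans hy.1.le, hy.2⟩)).aestronglyMeasurable measurableSet_Ioc⟩
    exact intervalIntegral.integral_hasDerivWithinAt_right (hint x ⟨hx.1, hx.2.le⟩) hm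
      (hcx.mono Ioi_subset_Ici_self)
  have hb := le_gronwallBound_of_liminf_deriv_right_le (δ := 0) (K := L) (ε := 0) hH
    (fun x hx r hr => (hd x hx).liminf_right_slope_le hr) (by simp)
    (fun x hx => by simpa using hle x ⟨hx.1, hx.2.le⟩) t ht
  rw [gronwallBound_ε0_δ0] at hb
  exact (hle t ht).trans (mul_nonpos_of_nonneg_of_nonpos hL hb)

/-! ### The embedding of `W_0^{1,r}` into `W_0^{1,2}` -/

/-- The inclusion `L^q ⊆ L^p` for `p ≤ q < ∞` and a finite measure, as a continuous linear map. -/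
noncomputable def lpInclusion {α F : Type*} [MeasurableSpace α] [NormedAddCommGroup F]
    [NormedSpace ℝ F] (μ : Measure α) [IsFiniteMeasure μ] {p q : ℝ≥0∞} [hp : Fact (1 ≤ p)]
    [Fact (1 ≤ q)] (hpq : p ≤ q) (hq : q ≠ ∞) : Lp F q μ →L[ℝ] Lp F p μ :=
  LinearMap.mkContinuous
    { toFun := fun u => ((Lp.memLp u).mono_exponent hpq).toLp u
      map_add' := fun u v => by
        rw [← MemLp.toLp_add]
        exact (MemLp.toLp_eq_toLp_iff _ _).2 (Lp.coeFn_add u v)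
      map_smul' := fun c u => by
        rw [RingHom.id_apply, ← MemLp.toLp_const_smul]
        exact (MemLp.toLp_eq_toLp_iff _ _).2 (Lp.coeFn_smul c u) }
    (μ univ ^ (1 / p.toReal - 1 / q.toReal)).toReal
    (fun u => by
      have hfin : μ univ ^ (1 / p.toReal - 1 / q.toReal) ≠ ∞ := by
        refine ENNReal.rpow_ne_top_of_nonneg (sub_nonneg.2 ?_) (measure_ne_top _ _)
        have hp0 : 0 < p.toReal :=
          ENNReal.toReal_pos (zero_lt_one.trans_le hp.out).ne' (ne_top_of_le_ne_top hq hpq)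
        exact one_div_le_one_div_of_le hp0 (ENNReal.toReal_mono hq hpq)
      change ‖((Lp.memLp u).mono_exponent hpq).toLp u‖ ≤ _
      rw [Lp.norm_toLp, Lp.norm_def, mul_comm, ← ENNReal.toReal_mul]
      exact ENNReal.toReal_mono (ENNReal.mul_ne_top (Lp.eLpNorm_ne_top u) hfin)
        (eLpNorm_le_eLpNorm_mul_rpow_measure_univ hpq (Lp.aestronglyMeasurable u)))

theorem coeFn_lpInclusion {α F : Type*} [MeasurableSpace α] [NormedAddCommGroup F]
    [NormedSpace ℝ F] (μ : Measure α) [IsFiniteMeasure μ] {p q : ℝ≥0∞} [Fact (1 ≤ p)]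
    [Fact (1 ≤ q)] (hpq : p ≤ q) (hq : q ≠ ∞) (u : Lp F q μ) :
    lpInclusion μ hpq hq u =ᵐ[μ] u :=
  MemLp.coeFn_toLp ((Lp.memLp u).mono_exponent hpq)

/-- The function underlying an element of `W_0^{1,r}(Ω)`, seen in `L^2(Ω)`. -/
noncomputable def toL2 {n : ℕ} (Ω : Opens (EuclideanSpace ℝ (Fin n))) {r : ℝ≥0∞} [Fact (1 ≤ r)]
    [IsFiniteMeasure (volume.restrict (Ω : Set (EuclideanSpace ℝ (Fin n))))]
    (h2 : 2 ≤ r) (hr : r ≠ ∞) :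
    W01p Ω r →L[ℝ] Lp ℝ 2 (volume.restrict (Ω : Set (EuclideanSpace ℝ (Fin n)))) :=
  (lpInclusion _ h2 hr).comp ((ContinuousLinearMap.fst ℝ _ _).comp
    ((W1p Ω r).subtypeL.comp (W01p Ω r).subtypeL))

/-- The weak gradient of an element of `W_0^{1,r}(Ω)`, seen in `L^2(Ω)^n`. -/
noncomputable def gradL2 {n : ℕ} (Ω : Opens (EuclideanSpace ℝ (Fin n))) {r : ℝ≥0∞} [Fact (1 ≤ r)]
    [IsFiniteMeasure (volume.restrict (Ω : Set (EuclideanSpace ℝ (Fin n))))]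
    (h2 : 2 ≤ r) (hr : r ≠ ∞) :
    W01p Ω r →L[ℝ]
      Lp (EuclideanSpace ℝ (Fin n)) 2 (volume.restrict (Ω : Set (EuclideanSpace ℝ (Fin n)))) :=
  (lpInclusion _ h2 hr).comp ((ContinuousLinearMap.snd ℝ _ _).comp
    ((W1p Ω r).subtypeL.comp (W01p Ω r).subtypeL))

theorem coeFn_toL2 {n : ℕ} (Ω : Opens (EuclideanSpace ℝ (Fin n))) {r : ℝ≥0∞} [Fact (1 ≤ r)]
    [IsFiniteMeasure (volume.restrict (Ω : Set (EuclideanSpace ℝ (Fin n))))]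
    (h2 : 2 ≤ r) (hr : r ≠ ∞) (w : W01p Ω r) :
    toL2 Ω h2 hr w =ᵐ[volume.restrict (Ω : Set (EuclideanSpace ℝ (Fin n)))] toLp w :=
  coeFn_lpInclusion _ h2 hr _

theorem coeFn_gradL2 {n : ℕ} (Ω : Opens (EuclideanSpace ℝ (Fin n))) {r : ℝ≥0∞} [Fact (1 ≤ r)]
    [IsFiniteMeasure (volume.restrict (Ω : Set (EuclideanSpace ℝ (Fin n))))]
    (h2 : 2 ≤ r) (hr : r ≠ ∞) (w : W01p Ω r) :
    gradL2 Ω h2 hr w =ᵐ[volume.restrict (Ω : Set (EuclideanSpace ℝ (Fin n)))] weakGrad w :=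
  coeFn_lpInclusion _ h2 hr _

/-- On a set of finite measure `W^{1,r}(Ω) ⊆ W^{1,2}(Ω)` for `2 ≤ r < ∞`. -/
theorem lpInclusion_mem_W1p {n : ℕ} (Ω : Opens (EuclideanSpace ℝ (Fin n))) {r : ℝ≥0∞}
    [Fact (1 ≤ r)] [IsFiniteMeasure (volume.restrict (Ω : Set (EuclideanSpace ℝ (Fin n))))]
    (h2 : 2 ≤ r) (hr : r ≠ ∞) (u : W1p Ω r) :
    (lpInclusion (volume.restrict (Ω : Set (EuclideanSpace ℝ (Fin n)))) h2 hr u.1.1,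
      lpInclusion (volume.restrict (Ω : Set (EuclideanSpace ℝ (Fin n)))) h2 hr u.1.2) ∈
      W1p Ω 2 := by
  intro φ i
  have e1 := coeFn_lpInclusion (volume.restrict (Ω : Set (EuclideanSpace ℝ (Fin n)))) h2 hr u.1.1
  have e2 := coeFn_lpInclusion (volume.restrict (Ω : Set (EuclideanSpace ℝ (Fin n)))) h2 hr u.1.2
  have h1 : ∫ x in Ω, lpInclusion (volume.restrict (Ω : Set (EuclideanSpace ℝ (Fin n)))) h2 hr
      u.1.1 x * fderiv ℝ φ x (EuclideanSpace.single i 1) =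
      ∫ x in Ω, u.1.1 x * fderiv ℝ φ x (EuclideanSpace.single i 1) :=
    integral_congr_ae (e1.mono fun x hx => by simp only [hx])
  have h3 : ∫ x in Ω, lpInclusion (volume.restrict (Ω : Set (EuclideanSpace ℝ (Fin n)))) h2 hr
      u.1.2 x i * φ x = ∫ x in Ω, u.1.2 x i * φ x :=
    integral_congr_ae (e2.mono fun x hx => by simp only [hx])
  rw [h1, h3]
  exact u.2 φ i

/-- On a set of finite measure `W_0^{1,r}(Ω) ⊆ W_0^{1,2}(Ω)` for `2 ≤ r < ∞`: an element of
`W_0^{1,r}(Ω)` can be used as a test function in the weak formulation. -/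
theorem exists_W01p_two_eq {n : ℕ} {Ω : Opens (EuclideanSpace ℝ (Fin n))} {r : ℝ≥0∞}
    [Fact (1 ≤ r)] [IsFiniteMeasure (volume.restrict (Ω : Set (EuclideanSpace ℝ (Fin n))))]
    (h2 : 2 ≤ r) (hr : r ≠ ∞) (w : W01p Ω r) :
    ∃ v : W01p Ω 2, toLp v = toL2 Ω h2 hr w ∧ weakGrad v = gradL2 Ω h2 hr w := by
  let J : W1p Ω r → W1p Ω 2 := fun u => ⟨_, lpInclusion_mem_W1p Ω h2 hr u⟩
  have hJc : Continuous J := by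
    refine Continuous.subtype_mk (Continuous.prodMk ?_ ?_) _
    · exact (lpInclusion _ h2 hr).continuous.comp (continuous_fst.comp continuous_subtype_val)
    · exact (lpInclusion _ h2 hr).continuous.comp (continuous_snd.comp continuous_subtype_val)
  have hJ : J w.1 ∈ W01p Ω 2 := by
    refine map_mem_closure hJc w.2 ?_
    rintro u ⟨φ, hφ⟩
    exact ⟨φ, (coeFn_lpInclusion _ h2 hr u.1.1).trans hφ⟩
  exact ⟨⟨J w.1, hJ⟩, rfl, rfl⟩

/-! ### The nonlinearity along a solution -/

/-- The composition of a Carathéodory function with a measurable function is measurable: simple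
functions are a countable gluing of constants, and continuity in the last variable allows to pass
to the limit. -/
theorem IsLocallyBoundedCaratheodory.aestronglyMeasurable_comp {n : ℕ} {T : ℝ}
    {Ω : Set (EuclideanSpace ℝ (Fin n))} {f : ℝ → EuclideanSpace ℝ (Fin n) → ℝ → ℝ}
    (hf : IsLocallyBoundedCaratheodory T Ω f) {y : ℝ × EuclideanSpace ℝ (Fin n) → ℝ}
    (hy : AEStronglyMeasurable y (volume.restrict (Icc 0 T ×ˢ Ω))) :
    AEStronglyMeasurable (fun z => f z.1 z.2 (y z)) (volume.restrict (Icc 0 T ×ˢ Ω)) := by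
  set μ := (volume : Measure (ℝ × EuclideanSpace ℝ (Fin n))).restrict (Icc 0 T ×ˢ Ω)
  have hs : ∀ s : SimpleFunc (ℝ × EuclideanSpace ℝ (Fin n)) ℝ,
      AEMeasurable (fun z => f z.1 z.2 (s z)) μ := by
    intro s
    have : (fun z => f z.1 z.2 (s z)) = fun z => ∑ c ∈ s.range,
        (s ⁻¹' {c}).indicator (fun z => f z.1 z.2 c) z := by
      funext z
      rw [Finset.sum_eq_single (s z)]
      · simp
      · intro c _ hc
        simp [hc.symm]
      · intro h
        exact absurd (s.mem_range_self z) h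
    rw [this]
    exact Finset.aemeasurable_fun_sum _ fun c _ =>
      (hf.aemeasurable c).indicator (s.measurableSet_preimage {c})
  have hmk := hy.stronglyMeasurable_mk
  refine AEMeasurable.aestronglyMeasurable ?_
  refine aemeasurable_of_tendsto_metrizable_ae Filter.atTop (fun k => hs (hmk.approx k)) ?_
  filter_upwards [hf.continuous, hy.ae_eq_mk] with z hz hyz
  rw [hyz]
  exact (hz.tendsto _).comp (hmk.tendsto_approx z)

/-- Lebesgue measure on the cylinder `(0,T) × Ω`, as a product measure, is dominated by Lebesgue
measure on `[0,T] × Ω`. -/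
theorem restrict_Ioo_prod_restrict_le {n : ℕ} (Ω : Opens (EuclideanSpace ℝ (Fin n))) (T : ℝ) :
    (volume.restrict (Ioo 0 T)).prod
      (volume.restrict (Ω : Set (EuclideanSpace ℝ (Fin n)))) ≤
      volume.restrict (Icc 0 T ×ˢ (Ω : Set (EuclideanSpace ℝ (Fin n)))) := by
  rw [Measure.prod_restrict]
  exact Measure.restrict_mono (prod_mono_left Ioo_subset_Icc_self) le_rfl

/-- Along a continuous function the nonlinearity is essentially bounded. -/
theorem exists_bound_nonlinearity {n : ℕ} {Ω : Opens (EuclideanSpace ℝ (Fin n))}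
    (hΩ : Bornology.IsBounded (Ω : Set (EuclideanSpace ℝ (Fin n)))) {T : ℝ}
    {f : ℝ → EuclideanSpace ℝ (Fin n) → ℝ → ℝ}
    (hf : IsLocallyBoundedCaratheodory T (Ω : Set (EuclideanSpace ℝ (Fin n))) f)
    {y : ℝ → EuclideanSpace ℝ (Fin n) → ℝ}
    (hy : ContinuousOn (fun z : ℝ × EuclideanSpace ℝ (Fin n) => y z.1 z.2)
      (Icc 0 T ×ˢ closure (Ω : Set (EuclideanSpace ℝ (Fin n))))) :
    AEStronglyMeasurable (fun z : ℝ × EuclideanSpace ℝ (Fin n) => f z.1 z.2 (y z.1 z.2))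
      ((volume.restrict (Ioo 0 T)).prod
        (volume.restrict (Ω : Set (EuclideanSpace ℝ (Fin n))))) ∧
    ∃ M : ℝ, ∀ᵐ z : ℝ × EuclideanSpace ℝ (Fin n) ∂(volume.restrict (Ioo 0 T)).prod
        (volume.restrict (Ω : Set (EuclideanSpace ℝ (Fin n)))), ‖f z.1 z.2 (y z.1 z.2)‖ ≤ M := by
  have hsub : Icc (0 : ℝ) T ×ˢ (Ω : Set (EuclideanSpace ℝ (Fin n))) ⊆
      Icc 0 T ×ˢ closure (Ω : Set (EuclideanSpace ℝ (Fin n))) :=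
    prod_mono_right subset_closure
  have hmeas : MeasurableSet (Icc (0 : ℝ) T ×ˢ (Ω : Set (EuclideanSpace ℝ (Fin n)))) :=
    measurableSet_Icc.prod Ω.isOpen.measurableSet
  have hle := restrict_Ioo_prod_restrict_le Ω T
  refine ⟨(hf.aestronglyMeasurable_comp ((hy.mono hsub).aestronglyMeasurable hmeas)).mono_measure
    hle, ?_⟩
  obtain ⟨M, -, hM⟩ := hf.bounded _
    ((isCompact_Icc.prod hΩ.isCompact_closure).image_of_continuousOn hy)
  refine ⟨M, ae_mono hle ?_⟩
  filter_upwards [hM, ae_restrict_mem hmeas] with z hz hzm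
  exact hz _ ⟨z, hsub hzm, rfl⟩

theorem continuous_toLp {n : ℕ} {Ω : Opens (EuclideanSpace ℝ (Fin n))} {p : ℝ≥0∞}
    [Fact (1 ≤ p)] : Continuous fun v : W01p Ω p => toLp v :=
  continuous_fst.comp (continuous_subtype_val.comp continuous_subtype_val)

theorem continuous_weakGrad {n : ℕ} {Ω : Opens (EuclideanSpace ℝ (Fin n))} {p : ℝ≥0∞}
    [Fact (1 ≤ p)] : Continuous fun v : W01p Ω p => weakGrad v :=
  continuous_snd.comp (continuous_subtype_val.comp continuous_subtype_val)

/-- The integral over the product of two `L²` functions, up to a.e. equal representatives. -/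
theorem integral_weak_form_eq_inner {α E : Type*} [MeasurableSpace α] {μ : Measure α}
    [NormedAddCommGroup E] [InnerProductSpace ℝ E] (a b : Lp ℝ 2 μ) (g h : Lp E 2 μ)
    {F b' : α → ℝ} {h' : α → E} (hF : MemLp F 2 μ) (hb : b =ᵐ[μ] b') (hh : h =ᵐ[μ] h') :
    ∫ x, (a x * b' x + ⟪g x, h' x⟫ - a x * F x) ∂μ = ⟪a, b⟫ + ⟪g, h⟫ - ∫ x, a x * F x ∂μ := by
  have j1 := L2.integrable_inner (𝕜 := ℝ) a b
  have j2 := L2.integrable_inner (𝕜 := ℝ) g h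
  have j3 : Integrable (fun x => a x * F x) μ := (Lp.memLp a).integrable_mul hF
  have j12 : Integrable (fun x => ⟪a x, b x⟫ + ⟪g x, h x⟫) μ := j1.add j2
  rw [L2.inner_def, L2.inner_def, ← integral_add j1 j2, ← integral_sub j12 j3]
  refine integral_congr_ae ?_
  filter_upwards [hb, hh] with x hx1 hx2
  simp only [← hx1, ← hx2]
  congr 2
  exact mul_comm _ _

theorem integral_mul_eq_inner_toLp {α : Type*} [MeasurableSpace α] {μ : Measure α}
    (a : Lp ℝ 2 μ) {F : α → ℝ} (hF : MemLp F 2 μ) :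
    ∫ x, a x * F x ∂μ = ⟪a, hF.toLp F⟫ := by
  rw [L2.inner_def]
  refine integral_congr_ae ?_
  filter_upwards [hF.coeFn_toLp] with x hx
  rw [hx]
  exact mul_comm _ _

theorem separableSpace_W01p {n : ℕ} (Ω : Opens (EuclideanSpace ℝ (Fin n))) (p : ℝ≥0∞)
    [Fact (1 ≤ p)] [Fact (p ≠ ∞)] : SeparableSpace (W01p Ω p) := by
  have : SecondCountableTopology (Lp (EuclideanSpace ℝ (Fin n)) p
      (volume.restrict (Ω : Set (EuclideanSpace ℝ (Fin n))))) := inferInstance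
  have : SecondCountableTopology (W1p Ω p) := TopologicalSpace.Subtype.secondCountableTopology _
  have : SecondCountableTopology (W01p Ω p) := TopologicalSpace.Subtype.secondCountableTopology _
  exact SecondCountableTopology.to_separableSpace

/-- For almost every time the nonlinearity along `y` is square integrable in space. -/
theorem ae_memLp_two_nonlinearity {n : ℕ} {Ω : Opens (EuclideanSpace ℝ (Fin n))}
    (hΩ : Bornology.IsBounded (Ω : Set (EuclideanSpace ℝ (Fin n)))) {T : ℝ}
    [IsFiniteMeasure (volume.restrict (Ω : Set (EuclideanSpace ℝ (Fin n))))]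
    {f : ℝ → EuclideanSpace ℝ (Fin n) → ℝ → ℝ}
    (hf : IsLocallyBoundedCaratheodory T (Ω : Set (EuclideanSpace ℝ (Fin n))) f)
    {y : ℝ → EuclideanSpace ℝ (Fin n) → ℝ}
    (hy : ContinuousOn (fun z : ℝ × EuclideanSpace ℝ (Fin n) => y z.1 z.2)
      (Icc 0 T ×ˢ closure (Ω : Set (EuclideanSpace ℝ (Fin n))))) :
    ∀ᵐ t ∂volume.restrict (Ioo 0 T), MemLp (fun x => f t x (y t x)) 2
      (volume.restrict (Ω : Set (EuclideanSpace ℝ (Fin n)))) := by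
  obtain ⟨hFm, M, hM⟩ := exists_bound_nonlinearity hΩ hf hy
  filter_upwards [Measure.ae_ae_of_ae_prod hM, hFm.prodMk_left] with t ht htm
  exact MemLp.of_bound htm M ht

set_option maxHeartbeats 1000000 in
/-- Localisation in time of the weak formulation, for a fixed test function in space. -/
theorem ae_weak_formulation {n : ℕ} {Ω : Opens (EuclideanSpace ℝ (Fin n))}
    (hΩ : Bornology.IsBounded (Ω : Set (EuclideanSpace ℝ (Fin n)))) {T : ℝ}
    [IsFiniteMeasure (volume.restrict (Ω : Set (EuclideanSpace ℝ (Fin n))))]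
    {r : ℝ≥0∞} [Fact (1 ≤ r)] (h2 : 2 ≤ r) (hr : r ≠ ∞)
    {f : ℝ → EuclideanSpace ℝ (Fin n) → ℝ → ℝ}
    (hf : IsLocallyBoundedCaratheodory T (Ω : Set (EuclideanSpace ℝ (Fin n))) f)
    {y : ℝ → EuclideanSpace ℝ (Fin n) → ℝ} {Y Y' : ℝ → W01p Ω r}
    (hy : RepresentsXr Ω r T y Y Y')
    (v : W01p Ω 2)
    (hweak : ∀ φ : 𝓓(timeInterval T, ℝ),
      ∫ t in Ioo 0 T, ∫ x in Ω, φ t * (toLp v x * toLp (Y' t) x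
        + ⟪weakGrad v x, weakGrad (Y t) x⟫ - toLp v x * f t x (y t x)) = 0) :
    ∀ᵐ t ∂volume.restrict (Ioo 0 T),
      ⟪toLp v, toL2 Ω h2 hr (Y' t)⟫ + ⟪weakGrad v, gradL2 Ω h2 hr (Y t)⟫
        - ∫ x in Ω, toLp v x * f t x (y t x) = 0 := by
  obtain ⟨hFm, M, hM⟩ := exists_bound_nonlinearity hΩ hf hy.continuousOn
  have i1 : IntegrableOn (fun t => ⟪toLp v, toL2 Ω h2 hr (Y' t)⟫) (Ioo 0 T) :=
    integrableOn_const_inner (hy.isH1.clm_comp (toL2 Ω h2 hr)).integrableOn_deriv _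
  have i2 : IntegrableOn (fun t => ⟪weakGrad v, gradL2 Ω h2 hr (Y t)⟫) (Ioo 0 T) :=
    integrableOn_const_inner (hy.isH1.clm_comp (gradL2 Ω h2 hr)).integrableOn _
  have i3 : IntegrableOn (fun t => ∫ x in Ω, toLp v x * f t x (y t x)) (Ioo 0 T) := by
    have hvi : Integrable (toLp v) (volume.restrict (Ω : Set (EuclideanSpace ℝ (Fin n)))) :=
      (Lp.memLp (toLp v)).integrable (by norm_num)
    exact ((hvi.comp_snd (volume.restrict (Ioo 0 T))).mul_bdd hFm hM).integral_prod_left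
  have i4 : IntegrableOn (fun t => ⟪toLp v, toL2 Ω h2 hr (Y' t)⟫
      + ⟪weakGrad v, gradL2 Ω h2 hr (Y t)⟫ - ∫ x in Ω, toLp v x * f t x (y t x)) (Ioo 0 T) :=
    (i1.add i2).sub i3
  refine ae_eq_zero_of_forall_testFunction i4 fun φ => ?_
  refine (integral_congr_ae ?_).trans (hweak φ)
  filter_upwards [ae_memLp_two_nonlinearity hΩ hf hy.continuousOn] with t ht
  have key := integral_weak_form_eq_inner (toLp v) (toL2 Ω h2 hr (Y' t)) (weakGrad v)
    (gradL2 Ω h2 hr (Y t)) ht (coeFn_toL2 Ω h2 hr (Y' t)) (coeFn_gradL2 Ω h2 hr (Y t))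
  exact ((integral_const_mul (φ t) _).trans (congrArg (φ t * ·) key)).symm

set_option maxHeartbeats 1000000 in
/-- Localisation in time of the weak formulation: since `W_0^{1,2}(Ω)` is separable, for almost
every time the equation holds against all test functions of the space variable simultaneously. -/
theorem ae_forall_weak_formulation {n : ℕ} {Ω : Opens (EuclideanSpace ℝ (Fin n))}
    (hΩ : Bornology.IsBounded (Ω : Set (EuclideanSpace ℝ (Fin n)))) {T : ℝ}
    [IsFiniteMeasure (volume.restrict (Ω : Set (EuclideanSpace ℝ (Fin n))))]
    {r : ℝ≥0∞} [Fact (1 ≤ r)] (h2 : 2 ≤ r) (hr : r ≠ ∞)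
    {f : ℝ → EuclideanSpace ℝ (Fin n) → ℝ → ℝ}
    (hf : IsLocallyBoundedCaratheodory T (Ω : Set (EuclideanSpace ℝ (Fin n))) f)
    {y : ℝ → EuclideanSpace ℝ (Fin n) → ℝ} {Y Y' : ℝ → W01p Ω r}
    (hy : RepresentsXr Ω r T y Y Y')
    (hweak : ∀ (v : W01p Ω 2) (φ : 𝓓(timeInterval T, ℝ)),
      ∫ t in Ioo 0 T, ∫ x in Ω, φ t * (toLp v x * toLp (Y' t) x
        + ⟪weakGrad v x, weakGrad (Y t) x⟫ - toLp v x * f t x (y t x)) = 0) :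
    ∀ᵐ t ∂volume.restrict (Ioo 0 T), ∀ v : W01p Ω 2,
      ⟪toLp v, toL2 Ω h2 hr (Y' t)⟫ + ⟪weakGrad v, gradL2 Ω h2 hr (Y t)⟫ =
        ∫ x in Ω, toLp v x * f t x (y t x) := by
  have : Fact ((2 : ℝ≥0∞) ≠ ∞) := ⟨by norm_num⟩
  have := separableSpace_W01p Ω 2
  have hall := ae_all_iff.2 fun k =>
    ae_weak_formulation hΩ h2 hr hf hy _ (hweak (denseSeq (W01p Ω 2) k))
  filter_upwards [hall, ae_memLp_two_nonlinearity hΩ hf hy.continuousOn] with t ht htF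
  intro v
  have hcl : IsClosed {v : W01p Ω 2 | ⟪toLp v, toL2 Ω h2 hr (Y' t)⟫
      + ⟪weakGrad v, gradL2 Ω h2 hr (Y t)⟫ = ⟪toLp v, htF.toLp (fun x => f t x (y t x))⟫} :=
    isClosed_eq ((continuous_toLp.inner continuous_const).add
      (continuous_weakGrad.inner continuous_const)) (continuous_toLp.inner continuous_const)
  refine Eq.trans ?_ (integral_mul_eq_inner_toLp (toLp v) htF).symm
  refine (denseRange_denseSeq (W01p Ω 2)).induction_on v hcl fun k => ?_
  exact (sub_eq_zero.1 (ht k)).trans (integral_mul_eq_inner_toLp _ htF)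

/-! ### The energy estimate -/

/-- If `Z ∈ H^1(0,T;H)` vanishes at time `0` and `⟪Z, Z'⟫ ≤ L ‖Z‖²`, then `Z` vanishes. The initial
condition is expressed through a continuous representative `h` of `‖Z‖²`. -/
theorem IsH1WithDeriv.eq_zero_of_inner_le {H : Type*} [NormedAddCommGroup H]
    [InnerProductSpace ℝ H] [CompleteSpace H] {T L : ℝ} (hT : 0 < T) (hL : 0 ≤ L) {Z Z' : ℝ → H}
    (hZ : IsH1WithDeriv T Z Z') {h : ℝ → ℝ} (hc : ContinuousOn h (Icc 0 T))
    (hh : ∀ᵐ t ∂volume.restrict (Ioo 0 T), h t = ‖Z t‖ ^ 2) (h0 : h 0 = 0)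
    (hle : ∀ᵐ t ∂volume.restrict (Ioo 0 T), ⟪Z t, Z' t⟫ ≤ L * ‖Z t‖ ^ 2) :
    ∀ t ∈ Icc 0 T, h t = 0 := by
  have hZc : IntegrableOn Z' (Ioc 0 T) :=
    (integrableOn_Ioc_iff_integrableOn_Ioo).2 hZ.integrableOn_deriv
  have hPc : ContinuousOn (fun t => ∫ s in Ioc 0 t, Z' s) (Icc 0 T) :=
    intervalIntegral.continuousOn_primitive ((integrableOn_Icc_iff_integrableOn_Ioc).2 hZc)
  -- comparing continuous representatives at time `0` determines the constant of integration
  obtain ⟨c, hZP⟩ := ae_eq_const_add_primitive hT hZ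
  have hk : EqOn h (fun t => ‖c + ∫ s in Ioc 0 t, Z' s‖ ^ 2) (Icc 0 T) := by
    refine Measure.eqOn_Icc_of_ae_eq volume hT.ne ?_ hc ((continuousOn_const.add hPc).norm.pow 2)
    rw [Filter.EventuallyEq, ← restrict_Ioo_eq_restrict_Icc]
    filter_upwards [hh, hZP] with t h1 h2
    rw [h1, h2]
  have hc0 : c = 0 := by
    have := hk (left_mem_Icc.2 hT.le)
    simpa [h0] using this.symm
  subst hc0
  simp only [zero_add] at hk hZP
  have hIoc : volume.restrict (Ioo 0 T) = volume.restrict (Ioc (0 : ℝ) T) :=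
    restrict_Ioo_eq_restrict_Ioc
  have hinner : IntegrableOn (fun s => ⟪∫ τ in Ioc 0 s, Z' τ, Z' s⟫) (Ioc 0 T) := by
    rw [IntegrableOn, ← hIoc]
    refine Integrable.mono' (hZ.memLp.norm.integrable_mul hZ.memLp_deriv.norm)
      (g := fun s => ‖Z s‖ * ‖Z' s‖) ?_ ?_
    · exact ((hPc.mono Ioo_subset_Icc_self).aestronglyMeasurable measurableSet_Ioo).inner
        hZ.memLp_deriv.aestronglyMeasurable
    · filter_upwards [hZP] with s hs
      rw [← hs]
      exact norm_inner_le_norm _ _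
  have hnonneg : ∀ t ∈ Icc 0 T, 0 ≤ h t := fun t ht => by
    rw [hk ht]
    exact sq_nonneg _
  have hbound : ∀ t ∈ Icc 0 T, h t ≤ 2 * L * ∫ s in (0 : ℝ)..t, h s := by
    intro t ht
    have hsub : Ioc 0 t ⊆ Ioc 0 T := Ioc_subset_Ioc_right ht.2
    rw [hk ht]
    beta_reduce
    rw [norm_sq_primitive (hZc.mono_set hsub), mul_assoc, intervalIntegral.integral_of_le ht.1,
      ← integral_const_mul L]
    refine mul_le_mul_of_nonneg_left (a := (2 : ℝ)) ?_ zero_le_two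
    refine integral_mono_ae (hinner.mono_set hsub)
      (((hc.mono (Icc_subset_Icc_right ht.2)).integrableOn_Icc.mono_set
        Ioc_subset_Icc_self).const_mul L) ?_
    have hle' := hle
    have hh' := hh
    rw [hIoc] at hle' hh' hZP
    filter_upwards [ae_mono (Measure.restrict_mono hsub le_rfl) hle',
      ae_mono (Measure.restrict_mono hsub le_rfl) hh',
      ae_mono (Measure.restrict_mono hsub le_rfl) hZP] with s h1 h2 h3
    rw [← h3, h2]
    exact h1
  intro t ht
  exact le_antisymm (le_zero_of_le_mul_integral (by positivity) hc hbound t ht) (hnonneg t ht)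

/-- The nonlinear term of the energy identity: `a = u - w` is the difference of two solutions and
`F`, `G` are the values of the nonlinearity along them. -/
theorem integral_mul_sub_le {α : Type*} [MeasurableSpace α] {μ : Measure α} {L : ℝ}
    (a : Lp ℝ 2 μ) {F G u w : α → ℝ} (hF : MemLp F 2 μ) (hG : MemLp G 2 μ)
    (ha : ∀ᵐ x ∂μ, a x = u x - w x)
    (hle : ∀ᵐ x ∂μ, (u x - w x) * (F x - G x) ≤ L * (u x - w x) ^ 2) :
    ∫ x, a x * F x ∂μ - ∫ x, a x * G x ∂μ ≤ L * ‖a‖ ^ 2 := by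
  have hiF : Integrable (fun x => a x * F x) μ := (Lp.memLp a).integrable_mul hF
  have hiG : Integrable (fun x => a x * G x) μ := (Lp.memLp a).integrable_mul hG
  rw [← real_inner_self_eq_norm_sq, L2.inner_def, ← integral_sub hiF hiG, ← integral_const_mul]
  refine integral_mono_ae (hiF.sub hiG) ((L2.integrable_inner a a).const_mul L) ?_
  filter_upwards [ha, hle] with x hx h
  rw [real_inner_self_eq_norm_sq, Real.norm_eq_abs, sq_abs, hx, ← mul_sub]
  exact h

/-- The one-sided Lipschitz condition along two continuous functions, on time slices. -/
theorem exists_ae_ae_one_sided_le {n : ℕ} {Ω : Opens (EuclideanSpace ℝ (Fin n))}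
    (hΩ : Bornology.IsBounded (Ω : Set (EuclideanSpace ℝ (Fin n)))) {T : ℝ}
    {f : ℝ → EuclideanSpace ℝ (Fin n) → ℝ → ℝ}
    (hf : IsLocallyOneSidedLipschitz T (Ω : Set (EuclideanSpace ℝ (Fin n))) f)
    {y z : ℝ → EuclideanSpace ℝ (Fin n) → ℝ}
    (hy : ContinuousOn (fun p : ℝ × EuclideanSpace ℝ (Fin n) => y p.1 p.2)
      (Icc 0 T ×ˢ closure (Ω : Set (EuclideanSpace ℝ (Fin n)))))
    (hz : ContinuousOn (fun p : ℝ × EuclideanSpace ℝ (Fin n) => z p.1 p.2)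
      (Icc 0 T ×ˢ closure (Ω : Set (EuclideanSpace ℝ (Fin n))))) :
    ∃ L : ℝ, 0 ≤ L ∧ ∀ᵐ t ∂volume.restrict (Ioo 0 T),
      ∀ᵐ x ∂volume.restrict (Ω : Set (EuclideanSpace ℝ (Fin n))),
        (y t x - z t x) * (f t x (y t x) - f t x (z t x)) ≤ L * (y t x - z t x) ^ 2 := by
  have hcpt : IsCompact (Icc (0 : ℝ) T ×ˢ closure (Ω : Set (EuclideanSpace ℝ (Fin n)))) :=
    isCompact_Icc.prod hΩ.isCompact_closure
  obtain ⟨L, hL0, hL⟩ := hf _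
    ((hcpt.image_of_continuousOn hy).union (hcpt.image_of_continuousOn hz))
  have hmeas : MeasurableSet (Icc (0 : ℝ) T ×ˢ (Ω : Set (EuclideanSpace ℝ (Fin n)))) :=
    measurableSet_Icc.prod Ω.isOpen.measurableSet
  have hprod : ∀ᵐ p : ℝ × EuclideanSpace ℝ (Fin n) ∂(volume.restrict (Ioo 0 T)).prod
      (volume.restrict (Ω : Set (EuclideanSpace ℝ (Fin n)))),
      (y p.1 p.2 - z p.1 p.2) * (f p.1 p.2 (y p.1 p.2) - f p.1 p.2 (z p.1 p.2)) ≤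
        L * (y p.1 p.2 - z p.1 p.2) ^ 2 := by
    refine ae_mono (restrict_Ioo_prod_restrict_le Ω T) ?_
    filter_upwards [hL, ae_restrict_mem hmeas] with p hp hpm
    have hpc : p ∈ Icc (0 : ℝ) T ×ˢ closure (Ω : Set (EuclideanSpace ℝ (Fin n))) :=
      ⟨hpm.1, subset_closure hpm.2⟩
    exact hp _ (.inl ⟨p, hpc, rfl⟩) _ (.inr ⟨p, hpc, rfl⟩)
  exact ⟨L, hL0, Measure.ae_ae_of_ae_prod hprod⟩

/-- Subtracting two equations in a Hilbert space and dropping the nonnegative term `‖g‖²`. -/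
theorem inner_sub_le_of_inner_add_eq {H G : Type*} [NormedAddCommGroup H] [InnerProductSpace ℝ H]
    [NormedAddCommGroup G] [InnerProductSpace ℝ G] (a A B : H) (g C D : G) {I J K : ℝ}
    (hg : g = C - D) (hI : ⟪a, A⟫ + ⟪g, C⟫ = I) (hJ : ⟪a, B⟫ + ⟪g, D⟫ = J) (hK : I - J ≤ K) :
    ⟪a, A - B⟫ ≤ K := by
  have h : 0 ≤ ⟪g, C - D⟫ := hg ▸ real_inner_self_nonneg
  rw [inner_sub_right] at h ⊢
  linarith

set_option maxHeartbeats 1000000 in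
/-- The energy inequality at a fixed time: `w₁`, `w₂` are the values and `w₁'`, `w₂'` the time
derivatives of two solutions, and their difference is the test function. -/
theorem inner_sub_le_of_weak_formulation {n : ℕ} {Ω : Opens (EuclideanSpace ℝ (Fin n))}
    [IsFiniteMeasure (volume.restrict (Ω : Set (EuclideanSpace ℝ (Fin n))))]
    {r : ℝ≥0∞} [Fact (1 ≤ r)] (h2 : 2 ≤ r) (hr : r ≠ ∞) {L : ℝ} (w₁ w₁' w₂ w₂' : W01p Ω r)
    {u₁ u₂ F₁ F₂ : EuclideanSpace ℝ (Fin n) → ℝ}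
    (hw₁ : toLp w₁ =ᵐ[volume.restrict (Ω : Set (EuclideanSpace ℝ (Fin n)))] u₁)
    (hw₂ : toLp w₂ =ᵐ[volume.restrict (Ω : Set (EuclideanSpace ℝ (Fin n)))] u₂)
    (hF₁ : MemLp F₁ 2 (volume.restrict (Ω : Set (EuclideanSpace ℝ (Fin n)))))
    (hF₂ : MemLp F₂ 2 (volume.restrict (Ω : Set (EuclideanSpace ℝ (Fin n)))))
    (hle : ∀ᵐ x ∂volume.restrict (Ω : Set (EuclideanSpace ℝ (Fin n))),
      (u₁ x - u₂ x) * (F₁ x - F₂ x) ≤ L * (u₁ x - u₂ x) ^ 2)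
    (h₁ : ∀ v : W01p Ω 2, ⟪toLp v, toL2 Ω h2 hr w₁'⟫ + ⟪weakGrad v, gradL2 Ω h2 hr w₁⟫ =
      ∫ x in Ω, toLp v x * F₁ x)
    (h₂ : ∀ v : W01p Ω 2, ⟪toLp v, toL2 Ω h2 hr w₂'⟫ + ⟪weakGrad v, gradL2 Ω h2 hr w₂⟫ =
      ∫ x in Ω, toLp v x * F₂ x) :
    ⟪toL2 Ω h2 hr w₁ - toL2 Ω h2 hr w₂, toL2 Ω h2 hr w₁' - toL2 Ω h2 hr w₂'⟫ ≤
      L * ‖toL2 Ω h2 hr w₁ - toL2 Ω h2 hr w₂‖ ^ 2 := by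
  refine (exists_W01p_two_eq h2 hr (w₁ - w₂)).elim fun v hv => ?_
  have hv1 := hv.1.trans (map_sub (toL2 Ω h2 hr) w₁ w₂)
  have hv2 := hv.2.trans (map_sub (gradL2 Ω h2 hr) w₁ w₂)
  rw [← hv1]
  have hae : ∀ᵐ x ∂volume.restrict (Ω : Set (EuclideanSpace ℝ (Fin n))),
      toLp v x = u₁ x - u₂ x := by
    rw [hv1]
    filter_upwards [Lp.coeFn_sub (toL2 Ω h2 hr w₁) (toL2 Ω h2 hr w₂),
      coeFn_toL2 Ω h2 hr w₁, coeFn_toL2 Ω h2 hr w₂, hw₁, hw₂] with x e1 e2 e3 e4 e5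
    rw [e1, Pi.sub_apply, e2, e3, e4, e5]
  have hmain := integral_mul_sub_le (toLp v) hF₁ hF₂ hae hle
  exact inner_sub_le_of_inner_add_eq _ _ _ _ _ _ hv2 (h₁ v) (h₂ v) hmain

/-- The one-sided Lipschitz condition turns the weak formulation for two solutions into a
differential inequality for the `L²` norm of their difference. -/
theorem ae_inner_sub_le {n : ℕ} {Ω : Opens (EuclideanSpace ℝ (Fin n))}
    (hΩ : Bornology.IsBounded (Ω : Set (EuclideanSpace ℝ (Fin n)))) {T : ℝ}
    [IsFiniteMeasure (volume.restrict (Ω : Set (EuclideanSpace ℝ (Fin n))))]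
    {r : ℝ≥0∞} [Fact (1 ≤ r)] (h2 : 2 ≤ r) (hr : r ≠ ∞)
    {f : ℝ → EuclideanSpace ℝ (Fin n) → ℝ → ℝ}
    (hf : IsLocallyBoundedCaratheodory T (Ω : Set (EuclideanSpace ℝ (Fin n))) f)
    (hfL : IsLocallyOneSidedLipschitz T (Ω : Set (EuclideanSpace ℝ (Fin n))) f)
    {y z : ℝ → EuclideanSpace ℝ (Fin n) → ℝ} {Y Y' Z Z' : ℝ → W01p Ω r}
    (hy : RepresentsXr Ω r T y Y Y') (hz : RepresentsXr Ω r T z Z Z')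
    (hwy : ∀ (v : W01p Ω 2) (φ : 𝓓(timeInterval T, ℝ)),
      ∫ t in Ioo 0 T, ∫ x in Ω, φ t * (toLp v x * toLp (Y' t) x
        + ⟪weakGrad v x, weakGrad (Y t) x⟫ - toLp v x * f t x (y t x)) = 0)
    (hwz : ∀ (v : W01p Ω 2) (φ : 𝓓(timeInterval T, ℝ)),
      ∫ t in Ioo 0 T, ∫ x in Ω, φ t * (toLp v x * toLp (Z' t) x
        + ⟪weakGrad v x, weakGrad (Z t) x⟫ - toLp v x * f t x (z t x)) = 0) :
    ∃ L : ℝ, 0 ≤ L ∧ ∀ᵐ t ∂volume.restrict (Ioo 0 T),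
      ⟪toL2 Ω h2 hr (Y t) - toL2 Ω h2 hr (Z t), toL2 Ω h2 hr (Y' t) - toL2 Ω h2 hr (Z' t)⟫ ≤
        L * ‖toL2 Ω h2 hr (Y t) - toL2 Ω h2 hr (Z t)‖ ^ 2 := by
  refine (exists_ae_ae_one_sided_le hΩ hfL hy.continuousOn hz.continuousOn).imp
    fun L hL => ⟨hL.1, ?_⟩
  filter_upwards [hL.2, hy.eq_slice, hz.eq_slice,
    ae_memLp_two_nonlinearity hΩ hf hy.continuousOn,
    ae_memLp_two_nonlinearity hΩ hf hz.continuousOn,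
    ae_forall_weak_formulation hΩ h2 hr hf hy hwy,
    ae_forall_weak_formulation hΩ h2 hr hf hz hwz] with t hlt hyt hzt hmy hmz hey hez
  exact inner_sub_le_of_weak_formulation h2 hr _ _ _ _ hyt hzt hmy hmz hlt hey hez

theorem continuousOn_integral_sq_sub {n : ℕ} {Ω : Opens (EuclideanSpace ℝ (Fin n))}
    (hΩ : Bornology.IsBounded (Ω : Set (EuclideanSpace ℝ (Fin n)))) {T : ℝ}
    {w : ℝ → EuclideanSpace ℝ (Fin n) → ℝ}
    (hw : ContinuousOn (fun p : ℝ × EuclideanSpace ℝ (Fin n) => w p.1 p.2)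
      (Icc 0 T ×ˢ closure (Ω : Set (EuclideanSpace ℝ (Fin n))))) :
    ContinuousOn (fun t => ∫ x in Ω, w t x ^ 2) (Icc 0 T) := by
  have hfin : IsFiniteMeasure (volume.restrict (Ω : Set (EuclideanSpace ℝ (Fin n)))) :=
    ⟨by simpa using hΩ.measure_lt_top⟩
  obtain ⟨C, hC⟩ := (isCompact_Icc.prod hΩ.isCompact_closure).exists_bound_of_continuousOn
    (hw.pow 2)
  have hmem := ae_restrict_mem (μ := volume) Ω.isOpen.measurableSet
  refine continuousOn_of_dominated (bound := fun _ => C) ?_ ?_ (integrable_const _) ?_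
  · intro t ht
    exact ContinuousOn.aestronglyMeasurable ((hw.pow 2).comp
      (continuousOn_const.prodMk continuousOn_id) fun x hx => ⟨ht, subset_closure hx⟩)
      Ω.isOpen.measurableSet
  · intro t ht
    filter_upwards [hmem] with x hx
    exact hC (t, x) ⟨ht, subset_closure hx⟩
  · filter_upwards [hmem] with x hx
    exact (hw.pow 2).comp (continuousOn_id.prodMk continuousOn_const)
      fun t ht => ⟨ht, subset_closure hx⟩

/-- A continuous function on the closure of a bounded open set whose square has integral zero
vanishes. -/
theorem eqOn_zero_of_integral_sq_eq_zero {n : ℕ} {Ω : Opens (EuclideanSpace ℝ (Fin n))}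
    (hΩ : Bornology.IsBounded (Ω : Set (EuclideanSpace ℝ (Fin n))))
    {w : EuclideanSpace ℝ (Fin n) → ℝ}
    (hw : ContinuousOn w (closure (Ω : Set (EuclideanSpace ℝ (Fin n)))))
    (h0 : ∫ x in Ω, w x ^ 2 = 0) :
    EqOn w 0 (closure (Ω : Set (EuclideanSpace ℝ (Fin n)))) := by
  have hi : IntegrableOn (fun x => w x ^ 2) (Ω : Set (EuclideanSpace ℝ (Fin n))) :=
    ((hw.pow 2).integrableOn_compact hΩ.isCompact_closure).mono_set subset_closure
  have hae := (integral_eq_zero_iff_of_nonneg (fun x => sq_nonneg (w x)) hi).1 h0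
  have hΩ0 : EqOn w 0 (Ω : Set (EuclideanSpace ℝ (Fin n))) := by
    refine Measure.eqOn_open_of_ae_eq (μ := volume) ?_ Ω.isOpen (hw.mono subset_closure)
      continuousOn_const
    filter_upwards [hae] with x hx
    simpa using hx
  exact hΩ0.of_subset_closure hw continuousOn_const subset_closure subset_rfl

end ReactionDiffusion

theorem proposition3p4 {n : ℕ} (hn : 1 ≤ n)
    (Ω : TopologicalSpace.Opens (EuclideanSpace ℝ (Fin n)))
    (hΩ_bounded : Bornology.IsBounded (Ω : Set (EuclideanSpace ℝ (Fin n))))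
    (hΩ_lipschitz : ReactionDiffusion.HasLocallyLipschitzBoundary
      (Ω : Set (EuclideanSpace ℝ (Fin n))))
    (T : ℝ) (hT : 0 < T)
    (r : ℝ≥0∞) [Fact (1 ≤ r)] (hr_two : 2 ≤ r) (hr_dim : (n : ℝ≥0∞) < r) (hr_top : r ≠ ∞)
    (f : ℝ → EuclideanSpace ℝ (Fin n) → ℝ → ℝ)
    (hf_bounded : ReactionDiffusion.IsLocallyBoundedCaratheodory T
      (Ω : Set (EuclideanSpace ℝ (Fin n))) f)
    (hf_lipschitz : ReactionDiffusion.IsLocallyOneSidedLipschitz T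
      (Ω : Set (EuclideanSpace ℝ (Fin n))) f)
    (y₀ : ReactionDiffusion.W01p Ω r)
    (y₁ y₂ : ℝ → EuclideanSpace ℝ (Fin n) → ℝ)
    (hy₁ : ReactionDiffusion.IsWeakSolution Ω r T f y₀ y₁)
    (hy₂ : ReactionDiffusion.IsWeakSolution Ω r T f y₀ y₂) :
    ∀ t ∈ Set.Icc 0 T, ∀ x ∈ closure (Ω : Set (EuclideanSpace ℝ (Fin n))), y₁ t x = y₂ t x := by
  have hfin : IsFiniteMeasure (volume.restrict (Ω : Set (EuclideanSpace ℝ (Fin n)))) :=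
    ⟨by simpa using hΩ_bounded.measure_lt_top⟩
  obtain ⟨Y₁, Y₁', hr₁, hw₁, hi₁⟩ := hy₁
  obtain ⟨Y₂, Y₂', hr₂, hw₂, hi₂⟩ := hy₂
  obtain ⟨L, hL0, hL⟩ := ReactionDiffusion.ae_inner_sub_le hΩ_bounded hr_two hr_top hf_bounded
    hf_lipschitz hr₁ hr₂ hw₁ hw₂
  have hwc : ContinuousOn (fun p : ℝ × EuclideanSpace ℝ (Fin n) => y₁ p.1 p.2 - y₂ p.1 p.2)
      (Icc 0 T ×ˢ closure (Ω : Set (EuclideanSpace ℝ (Fin n)))) :=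
    hr₁.continuousOn.sub hr₂.continuousOn
  have hZ := (hr₁.isH1.clm_comp (ReactionDiffusion.toL2 Ω hr_two hr_top)).sub
    (hr₂.isH1.clm_comp (ReactionDiffusion.toL2 Ω hr_two hr_top))
  have hzero := hZ.eq_zero_of_inner_le hT hL0
    (h := fun t => ∫ x in Ω, (y₁ t x - y₂ t x) ^ 2)
    (ReactionDiffusion.continuousOn_integral_sq_sub hΩ_bounded hwc) ?_ ?_ hL
  · intro t ht x hx
    refine sub_eq_zero.1 (ReactionDiffusion.eqOn_zero_of_integral_sq_eq_zero hΩ_bounded ?_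
      (hzero t ht) hx)
    exact hwc.comp (continuousOn_const.prodMk continuousOn_id) fun x hx => ⟨ht, hx⟩
  · filter_upwards [hr₁.eq_slice, hr₂.eq_slice] with t h1 h2
    rw [← real_inner_self_eq_norm_sq, L2.inner_def]
    refine integral_congr_ae ?_
    filter_upwards [Lp.coeFn_sub (ReactionDiffusion.toL2 Ω hr_two hr_top (Y₁ t))
      (ReactionDiffusion.toL2 Ω hr_two hr_top (Y₂ t)),
      ReactionDiffusion.coeFn_toL2 Ω hr_two hr_top (Y₁ t),
      ReactionDiffusion.coeFn_toL2 Ω hr_two hr_top (Y₂ t), h1, h2] with x e1 e2 e3 e4 e5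
    rw [real_inner_self_eq_norm_sq, Real.norm_eq_abs, sq_abs, e1, Pi.sub_apply, e2, e3, e4, e5]
  · refine integral_eq_zero_of_ae ?_
    filter_upwards [hi₁, hi₂] with x h1 h2
    simp [h1, h2]
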